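/- Let $V$ be a finite set and let $X_v$ ($v\in V$) be random variables with finite state spaces $\mathfrak{X}_v$, each having at least two elements; put $\mathfrak{X}=\prod_{v}\mathfrak{X}_v$ and let $\Delta^\circ\subset\mathbb{R}^{\mathfrak{X}}$ be the set of strictly positive probability vectors on $\mathfrak{X}$. For a directed acyclic graph $\mathcal{G}$ on $V$, the Bayesian network model $\mathcal{M}(\mathcal{G})\subseteq\Delta^\circ$ consists of all $p\in\Delta^\circ$ that factorize as $p(x)=\prod_{v}\kappa_v(x_v\mid x_{\mathrm{pa}(v)})$ with conditional probability tables $\kappa_v$. The tangent cone $\mathrm{TC}_\theta(\mathcal{M})$ is the set of limits of sequences $\alpha_n(\theta_n-\theta)$ with $\alpha_n>0$, $\theta_n\in\mathcal{M}$, $\theta_n\to\theta$. Two models $\mathcal{M}_1,\mathcal{M}_2$ overlap at $\theta\in\mathcal{M}_1\cap\mathcal{M}_2$ if there is $h\in\mathrm{TC}_\theta(\mathcal{M}_1)\cap\mathrm{TC}_\theta(\mathcal{M}_2)$ with $h\notin\mathrm{TC}_\theta(\mathcal{M}_1\cap\mathcal{M}_2)$. A class of models is simultaneously convex near $\theta\in\Delta^\circ$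 if there are a neighbourhood $W$ of $\theta$ in $\Delta^\circ$ (possibly $W=\Delta^\circ$), an open set $\Theta\subseteq\mathbb{R}^{|\mathfrak{X}|-1}$ and a twice differentiable bijection $\psi:\Theta\to W$ with Jacobian of full column rank everywhere, such that, for every model $\mathcal{M}$ in the class, $\psi^{-1}(\mathcal{M})$ is convex in a neighbourhood of $\psi^{-1}(\theta)$. (1) Let $\mathcal{G}_1,\mathcal{G}_2$ be directed acyclic graphs on $V$ such that $i\to k\leftarrow j$ is an unshielded collider in $\mathcal{G}_1$ (that is, $i\neq j$ are not joined by an edge), while $i,k,j$ is an unshielded noncollider in $\mathcal{G}_2$ ($i,j$ are not joined, both are joined to $k$, and not both edges point to $k$). If $X_k$ is binary, then there is a point $\theta$ at which $\mathcal{M}(\mathcal{G}_1)$ and $\mathcal{M}(\mathcal{G}_2)$ overlap and near which they are not simultaneously convex. (2) Consequently, if $|V|\ge 3$ and at least one of the variables is binary, there is a point $\theta$ common to all Bayesian network models on $V$ near which the class of all these models is not simultaneously convex. Thus the convex parameterization of the candidate models on which lasso-type convex model selection methods rely does not exist for Bayesian networks. -/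

import Mathlib

open Filter Topology

/-! ### Directed acyclic graphs, colliders and noncolliders -/

/-- A directed graph (`G.Adj u v` is the edge `u → v`) without directed cycles. -/
def Digraph.IsDAG {V : Type*} (G : Digraph V) : Prop :=
  ∀ v, ¬ Relation.TransGen G.Adj v v

/-- `u` and `v` are joined by an edge, in one direction or the other. -/
def Digraph.Joined {V : Type*} (G : Digraph V) (u v : V) : Prop :=
  G.Adj u v ∨ G.Adj v u

/-- `i → k ← j` is an unshielded collider: `i` and `j` are distinct and not joined. -/
def Digraph.UnshieldedCollider {V : Type*} (G : Digraph V) (i k j : V) : Prop :=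
  i ≠ j ∧ ¬ G.Joined i j ∧ G.Adj i k ∧ G.Adj j k

/-- The path `i, k, j` is an unshielded noncollider: `i` and `j` are distinct and not joined, both
are joined to `k`, and the two edges do not both point to `k`. -/
def Digraph.UnshieldedNoncollider {V : Type*} (G : Digraph V) (i k j : V) : Prop :=
  i ≠ j ∧ ¬ G.Joined i j ∧ G.Joined i k ∧ G.Joined j k ∧ ¬ (G.Adj i k ∧ G.Adj j k)

/-! ### Discrete Bayesian network models -/

/-- Strictly positive probability vectors on a finite set (the open probability simplex). -/
def openSimplex (S : Type*) [Fintype S] : Set (S → ℝ) :=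
  {p | (∀ x, 0 < p x) ∧ ∑ x, p x = 1}

/-- The discrete Bayesian network model of `G` for variables `X_v` with finite state spaces `X v`:
the strictly positive joint distributions that factorize as `p(x) = ∏ v, κ_v(x_v | x_pa(v))`, where
each `κ_v(· | c)` is a probability vector on `X v`, for each configuration `c` of the parents. -/
def bayesNetModel {V : Type*} [Fintype V] [DecidableEq V] (X : V → Type*) [∀ v, Fintype (X v)]
    (G : Digraph V) : Set ((∀ v, X v) → ℝ) :=
  {p | p ∈ openSimplex (∀ v, X v) ∧
    ∃ κ : ∀ v : V, (∀ u : {u : V // G.Adj u v}, X u) → X v → ℝ,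
      (∀ v c a, 0 ≤ κ v c a) ∧ (∀ v c, ∑ a, κ v c a = 1) ∧
      ∀ x, p x = ∏ v, κ v (fun u => x u) (x v)}

/-- The class of all Bayesian network models for the variables `X_v`. -/
def bayesNetModels {V : Type*} [Fintype V] [DecidableEq V] (X : V → Type*)
    [∀ v, Fintype (X v)] : Set (Set ((∀ v, X v) → ℝ)) :=
  {M | ∃ G : Digraph V, G.IsDAG ∧ M = bayesNetModel X G}

/-! ### Tangent cones and overlap -/

/-- The tangent cone of `M` at `θ`: limits of `α n • (t n - θ)` with `α n > 0`, `t n ∈ M` and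
`t n → θ`. (`tangentConeAt ℝ` would also allow negative scalars.) -/
def modelTangentCone {E : Type*} [AddCommGroup E] [Module ℝ E] [TopologicalSpace E]
    (M : Set E) (θ : E) : Set E :=
  {h | ∃ (α : ℕ → ℝ) (t : ℕ → E), (∀ n, 0 < α n) ∧ (∀ n, t n ∈ M) ∧
    Tendsto t atTop (𝓝 θ) ∧ Tendsto (fun n => α n • (t n - θ)) atTop (𝓝 h)}

/-- `M₁` and `M₂` overlap at the common point `θ`: some vector is tangent at `θ` to both models
but not to their intersection. -/
def OverlapAt {E : Type*} [AddCommGroup E] [Module ℝ E] [TopologicalSpace E]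
    (M₁ M₂ : Set E) (θ : E) : Prop :=
  θ ∈ M₁ ∩ M₂ ∧ ∃ h, h ∈ modelTangentCone M₁ θ ∩ modelTangentCone M₂ θ ∧
    h ∉ modelTangentCone (M₁ ∩ M₂) θ

/-! ### Parameterizations and simultaneous convexity -/

/-- `ψ`, restricted to the open set `Θ`, is a parameterization of the set `D` of distributions:
a bijection of `Θ` onto `D` that is twice differentiable with Jacobian of full column rank. -/
structure IsParameterization {E F : Type*} [NormedAddCommGroup E] [NormedSpace ℝ E]
    [NormedAddCommGroup F] [NormedSpace ℝ F] (ψ : E → F) (Θ : Set E) (D : Set F) : Prop where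
  isOpen : IsOpen Θ
  bijOn : Set.BijOn ψ Θ D
  differentiableOn : DifferentiableOn ℝ ψ Θ
  twice_differentiableOn : DifferentiableOn ℝ (fderiv ℝ ψ) Θ
  full_rank : ∀ t ∈ Θ, Function.Injective (fderiv ℝ ψ t)

/-- The set `C` is convex in a neighbourhood of `η`. -/
def ConvexNear {E : Type*} [AddCommGroup E] [Module ℝ E] [TopologicalSpace E]
    (C : Set E) (η : E) : Prop :=
  ∃ N ∈ 𝓝 η, Convex ℝ (C ∩ N)

/-- There is a parameterization of the distributions on `S` in a neighbourhood `W` of `θ`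
(`W = Set.univ` is allowed and gives a parameterization of all of them) by an open set of
`ℝ^(|S| - 1)` under which every model in the class `𝓜` is convex in a neighbourhood of the
parameter of `θ`. -/
def SimultaneouslyConvexNear {S : Type*} [Fintype S] (𝓜 : Set (Set (S → ℝ))) (θ : S → ℝ) : Prop :=
  ∃ (W : Set (S → ℝ)) (Θ : Set (EuclideanSpace ℝ (Fin (Fintype.card S - 1))))
    (ψ : EuclideanSpace ℝ (Fin (Fintype.card S - 1)) → (S → ℝ)),
    IsOpen W ∧ IsParameterization ψ Θ (W ∩ openSimplex S) ∧
    ∃ η ∈ Θ, ψ η = θ ∧ ∀ M ∈ 𝓜, ConvexNear (Θ ∩ ψ ⁻¹' M) η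

/-! ### Sums over configurations -/

section Sums

variable {V : Type*} [Fintype V] [DecidableEq V] {X : V → Type*} [∀ v, Fintype (X v)]

/-! The base point is the uniform distribution. There the tangent cone of a Bayesian network is a
linear space, spanned by centred interactions of each vertex with its parents
(`modelTangentCone_bayesNetModel`). A pairwise interaction along an edge does not reveal the
direction of the edge. Hence, for centred `a`, `b`, `c`, the vector with density `(a(x_i) + c(x_j))
b(x_k)` relative to the uniform distribution is tangent to both models.

The second order separates them. Along a sequence in one model with this tangent vector and scaling
`α n`, the mean of `a(X_i) c(X_j)` times `α n ^ 2` tends to 0 under the collider, and to a positive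
number under the noncollider, where `k` transmits dependence between `i` and `j`. A sequence in the
intersection would have both limits, so the models overlap (`overlapAt_uniformPoint`).

Overlap excludes convexity (`OverlapAt.not_simultaneouslyConvexNear`). A parameterization pulls
linear tangent cones back to linear ones, and a convex set with linear tangent cone contains a
segment in each tangent direction. Both parameter sets would share a segment, whose image is a curve
in the intersection with the forbidden tangent vector. -/

theorem sum_sum_update (v : V) (Φ : (∀ v, X v) → ℝ) :
    ∑ x, ∑ a, Φ (Function.update x v a) = Fintype.card (X v) * ∑ x, Φ x := by
  -- Exchanging the coordinate `x v` with the spare state `a` permutes the pairs `(x, a)`.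
  have hinv : Function.Involutive
      (fun z : (∀ v, X v) × X v => (Function.update z.1 v z.2, z.1 v)) := by
    rintro ⟨x, a⟩
    simp
  have h1 : ∑ z : (∀ v, X v) × X v, Φ (Function.update z.1 v z.2) =
      ∑ z : (∀ v, X v) × X v, Φ z.1 :=
    Fintype.sum_bijective _ hinv.bijective _ _ (fun _ => rfl)
  rw [Fintype.sum_prod_type, Fintype.sum_prod_type] at h1
  simp only [h1, Finset.sum_const, Finset.card_univ, nsmul_eq_mul, Finset.mul_sum]

variable [∀ v, Nonempty (X v)]

theorem sum_mul_of_fiber_sum (v : V) {H q : (∀ v, X v) → ℝ} {s : ℝ}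
    (hH : ∀ x a, H (Function.update x v a) = H x)
    (hq : ∀ x, ∑ a, q (Function.update x v a) = s) :
    ∑ x, H x * q x = (Fintype.card (X v) : ℝ)⁻¹ * s * ∑ x, H x := by
  have h := sum_sum_update v (fun x => H x * q x)
  have hc : (Fintype.card (X v) : ℝ) ≠ 0 := by
    exact_mod_cast Fintype.card_ne_zero
  simp only [hH, ← Finset.mul_sum, hq] at h
  rw [← Finset.sum_mul] at h
  field_simp
  linarith

theorem sum_mul_eq_zero_of_fiber_sum (v : V) {H q : (∀ v, X v) → ℝ}
    (hH : ∀ x a, H (Function.update x v a) = H x)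
    (hq : ∀ x, ∑ a, q (Function.update x v a) = 0) :
    ∑ x, H x * q x = 0 := by
  rw [sum_mul_of_fiber_sum v hH hq]
  simp

/-- The factors are summed out in order of decreasing rank: when `a` has maximal rank, neither `F`
nor the remaining factors involve `x a`, so `q a` is replaced by its fibre average. -/
theorem sum_mul_prod_of_rank (r : V → ℕ) (q : V → (∀ v, X v) → ℝ)
    (hq : ∀ v x, ∑ a, q v (Function.update x v a) = 1)
    (hdep : ∀ v u x a, u ≠ v → r v ≤ r u → q v (Function.update x u a) = q v x)
    (D : Finset V) :
    ∀ F : (∀ v, X v) → ℝ, (∀ v ∈ D, ∀ x a, F (Function.update x v a) = F x) →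
      ∑ x, F x * ∏ v ∈ D, q v x = (∏ v ∈ D, (Fintype.card (X v) : ℝ)⁻¹) * ∑ x, F x := by
  refine Finset.induction_on_max_value r D (by simp) fun a s has hmax ih F hF => ?_
  · have h1 : ∑ x, F x * ∏ v ∈ insert a s, q v x = ∑ x, (F x * ∏ v ∈ s, q v x) * q a x := by
      refine Finset.sum_congr rfl fun x _ => ?_
      rw [Finset.prod_insert has]
      ring
    rw [h1, sum_mul_of_fiber_sum a (s := 1) _ (hq a),
      ih F fun v hv => hF v (Finset.mem_insert_of_mem hv), Finset.prod_insert has]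
    · ring
    · intro x b
      rw [hF a (Finset.mem_insert_self a s)]
      congr 1
      refine Finset.prod_congr rfl fun v hv => hdep v a x b ?_ (hmax v hv)
      rintro rfl
      exact has hv

end Sums

/-! ### The local Markov property -/

theorem Digraph.IsDAG.exists_rank {V : Type*} [Finite V] {G : Digraph V} (hG : G.IsDAG) :
    ∃ r : V → ℕ, ∀ u v, G.Adj u v → r u < r v := by
  -- The rank counts ancestors. It increases strictly along `u → v` because `u` is an ancestor of
  -- `v` but not of itself.
  refine ⟨fun v => Set.ncard {u | Relation.TransGen G.Adj u v}, fun u v huv => ?_⟩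
  refine Set.ncard_lt_ncard ⟨fun w hw => Relation.TransGen.tail hw huv, fun hsub => ?_⟩
    (Set.toFinite _)
  exact hG u (hsub (Relation.TransGen.single huv))

theorem Digraph.IsDAG.irrefl {V : Type*} {G : Digraph V} (hG : G.IsDAG) (v : V) : ¬ G.Adj v v :=
  fun h => hG v (Relation.TransGen.single h)

/-- The configuration of the parents of `v`. -/
def parentConfig {V : Type*} {X : V → Type*} (G : Digraph V) (v : V) (x : ∀ v, X v) :
    ∀ u : {u : V // G.Adj u v}, X u :=
  fun u => x u

theorem parentConfig_update {V : Type*} [DecidableEq V] {X : V → Type*} {G : Digraph V} {v w : V}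
    (h : ¬ G.Adj w v) (x : ∀ v, X v) (a : X w) :
    parentConfig G v (Function.update x w a) = parentConfig G v x := by
  funext u
  refine Function.update_of_ne ?_ _ _
  rintro hu
  exact h (hu ▸ u.2)

section Tables

variable {V : Type*} [DecidableEq V] {X : V → Type*}

/-- Families of conditional tables, indexed by a vertex, a parent configuration and a state. -/
abbrev Tables (X : V → Type*) (G : Digraph V) : Type _ :=
  ∀ v : V, (∀ u : {u : V // G.Adj u v}, X u) → X v → ℝ

theorem table_update_self {G : Digraph V} (hG : G.IsDAG) (κ : Tables X G) (v : V) (x : ∀ v, X v)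
    (a : X v) :
    κ v (parentConfig G v (Function.update x v a)) (Function.update x v a v) =
      κ v (parentConfig G v x) a := by
  rw [parentConfig_update (hG.irrefl v), Function.update_self]

theorem table_update_of_ne {G : Digraph V} (κ : Tables X G) {v w : V} (hvw : w ≠ v)
    (h : ¬ G.Adj w v) (x : ∀ v, X v) (a : X w) :
    κ v (parentConfig G v (Function.update x w a)) (Function.update x w a v) =
      κ v (parentConfig G v x) (x v) := by
  rw [parentConfig_update h, Function.update_of_ne hvw.symm]

end Tables

section Markov

variable {V : Type*} [Fintype V] [DecidableEq V] {X : V → Type*} [∀ v, Fintype (X v)]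
variable [∀ v, Nonempty (X v)]

theorem sum_prod_tables {G : Digraph V} (hG : G.IsDAG) {κ : Tables X G}
    (hκ : ∀ v c, ∑ a, κ v c a = 1) :
    ∑ x, ∏ v, κ v (parentConfig G v x) (x v) = 1 := by
  obtain ⟨r, hr⟩ := hG.exists_rank
  have h := sum_mul_prod_of_rank r (fun v x => κ v (parentConfig G v x) (x v))
    (fun v x => by simp only [table_update_self hG, hκ])
    (fun v u x a huv hru => table_update_of_ne κ huv (fun h => (hr u v h).not_ge hru) x a)
    Finset.univ (fun _ => 1) (by simp)
  simp only [one_mul] at h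
  rw [h]
  simp only [Finset.sum_const, Finset.card_univ, nsmul_eq_mul, mul_one, Fintype.card_pi,
    Nat.cast_prod]
  rw [← Finset.prod_mul_distrib]
  refine Finset.prod_eq_one fun v _ => inv_mul_cancel₀ ?_
  exact_mod_cast Fintype.card_ne_zero

/-- The residual of `g(x_j)` given the parents of `j` is orthogonal to every function of the
nondescendants of `j`. -/
theorem sum_prod_tables_mul_residual {G : Digraph V} (hG : G.IsDAG) {κ : Tables X G}
    (hκ : ∀ v c, ∑ a, κ v c a = 1) (j : V) (F : (∀ v, X v) → ℝ)
    (hFj : ∀ x a, F (Function.update x j a) = F x)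
    (hF : ∀ w, Relation.TransGen G.Adj j w → ∀ x a, F (Function.update x w a) = F x)
    (g : X j → ℝ) :
    ∑ x, (∏ v, κ v (parentConfig G v x) (x v)) *
      (F x * (g (x j) - ∑ a, κ j (parentConfig G j x) a * g a)) = 0 := by
  classical
  obtain ⟨r, hr⟩ := hG.exists_rank
  set q : V → (∀ v, X v) → ℝ := fun v x => κ v (parentConfig G v x) (x v) with hqdef
  have hq1 : ∀ v x, ∑ a, q v (Function.update x v a) = 1 := fun v x => by
    simp only [hqdef, table_update_self hG, hκ]
  have hqne : ∀ v w x a, w ≠ v → ¬ G.Adj w v → q v (Function.update x w a) = q v x :=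
    fun v w x a hvw h => table_update_of_ne κ hvw h x a
  -- `D` is closed under children, so no factor outside `D` involves the coordinates in `D`, and the
  -- factors in `D` sum out. What is left is `H`, free of `x j` because the children of `j` lie in
  -- `D`, times the weighted residual, whose fibre sums over `x j` vanish.
  set D : Finset V := Finset.univ.filter fun w => Relation.TransGen G.Adj j w with hD
  have hjD : j ∉ D := by simpa [hD] using hG j
  set R : (∀ v, X v) → ℝ := fun x => g (x j) - ∑ a, κ j (parentConfig G j x) a * g a with hR
  set H : (∀ v, X v) → ℝ := fun x => F x * ∏ v ∈ Dᶜ.erase j, q v x with hH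
  have hfac : ∀ x, (∏ v, q v x) * (F x * R x) = (H x * (q j x * R x)) * ∏ v ∈ D, q v x := by
    intro x
    rw [← Finset.prod_mul_prod_compl D, ← Finset.mul_prod_erase Dᶜ _ (Finset.mem_compl.2 hjD)]
    simp only [hH]
    ring
  have hHj : ∀ x a, H (Function.update x j a) = H x := by
    intro x a
    simp only [hH, hFj]
    congr 1
    refine Finset.prod_congr rfl fun v hv => hqne v j x a (Finset.ne_of_mem_erase hv).symm ?_
    intro hjv
    have := Finset.mem_of_mem_erase hv
    simp only [hD, Finset.mem_compl, Finset.mem_filter, Finset.mem_univ, true_and] at this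
    exact this (Relation.TransGen.single hjv)
  have hfree : ∀ w ∈ D, ∀ x a,
      H (Function.update x w a) * (q j (Function.update x w a) * R (Function.update x w a)) =
        H x * (q j x * R x) := by
    intro w hw x a
    have hwD : Relation.TransGen G.Adj j w := by simpa [hD] using hw
    have hwj : w ≠ j := fun h => hjD (h ▸ hw)
    have hnadj : ∀ v ∉ D, ¬ G.Adj w v := fun v hv hwv =>
      hv (by simpa [hD] using hwD.tail hwv)
    have hprod : ∏ v ∈ Dᶜ.erase j, q v (Function.update x w a) = ∏ v ∈ Dᶜ.erase j, q v x := by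
      refine Finset.prod_congr rfl fun v hv => ?_
      have hv' : v ∉ D := Finset.mem_compl.1 (Finset.mem_of_mem_erase hv)
      exact hqne v w x a (fun h => hv' (h ▸ hw)) (hnadj v hv')
    simp only [hH, hR, hF w hwD, hqne j w x a hwj (hnadj j hjD),
      parentConfig_update (hnadj j hjD), Function.update_of_ne hwj.symm, hprod]
  have hres : ∀ x, ∑ a, q j (Function.update x j a) * R (Function.update x j a) = 0 := by
    intro x
    simp only [hqdef, hR, table_update_self hG, parentConfig_update (hG.irrefl j),
      Function.update_self, mul_sub, Finset.sum_sub_distrib, ← Finset.sum_mul, hκ, one_mul,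
      sub_self]
  refine (Finset.sum_congr rfl fun x _ => hfac x).trans ?_
  rw [sum_mul_prod_of_rank r q hq1
    (fun v u x a huv hru => hqne v u x a huv (fun h => (hr u v h).not_ge hru)) D
    (fun x => H x * (q j x * R x)) hfree,
    sum_mul_eq_zero_of_fiber_sum j hHj hres, mul_zero]

end Markov

/-! ### Tangent cones of Bayesian network models at the uniform distribution -/

theorem mem_modelTangentCone_of_eventually {E : Type*} [AddCommGroup E] [Module ℝ E]
    [TopologicalSpace E] {M : Set E} {θ h : E} {α : ℕ → ℝ} {t : ℕ → E}
    (hα : ∀ᶠ n in atTop, 0 < α n) (htM : ∀ᶠ n in atTop, t n ∈ M)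
    (ht : Tendsto t atTop (𝓝 θ)) (h' : Tendsto (fun n => α n • (t n - θ)) atTop (𝓝 h)) :
    h ∈ modelTangentCone M θ := by
  obtain ⟨N, hN⟩ := eventually_atTop.1 (hα.and htM)
  exact ⟨fun n => α (n + N), fun n => t (n + N), fun n => (hN _ (Nat.le_add_left _ _)).1,
    fun n => (hN _ (Nat.le_add_left _ _)).2, ht.comp (tendsto_add_atTop_nat N),
    h'.comp (tendsto_add_atTop_nat N)⟩

/-- The product rule along a sequence, with `l` as the logarithmic derivatives of the factors. -/
theorem tendsto_mul_prod_sub_prod {ι : Type*} {α : ℕ → ℝ} {κ : ℕ → ι → ℝ} {u l : ι → ℝ}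
    (hκ : ∀ v, Tendsto (fun n => κ n v) atTop (𝓝 (u v)))
    (hd : ∀ v, Tendsto (fun n => α n * (κ n v - u v)) atTop (𝓝 (u v * l v))) (s : Finset ι) :
    Tendsto (fun n => α n * (∏ v ∈ s, κ n v - ∏ v ∈ s, u v)) atTop
      (𝓝 ((∏ v ∈ s, u v) * ∑ v ∈ s, l v)) := by
  classical
  induction s using Finset.induction_on with
  | empty => simp
  | insert a s ha ih =>
    have h := ((hd a).mul (tendsto_finsetProd s fun v _ => hκ v)).add (ih.const_mul (u a))
    rw [Finset.prod_insert ha, Finset.sum_insert ha]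
    convert h using 2
    · simp only [Finset.prod_insert ha]
      ring
    · ring

section ParentIndicator

variable {V : Type*} {X : V → Type*}

/-- The indicator of the event that the parents of `j` are in configuration `c`. -/
noncomputable def parentIndicator (G : Digraph V) (j : V) (c : ∀ u : {u : V // G.Adj u j}, X u)
    (x : ∀ v, X v) : ℝ :=
  Set.indicator {c} 1 (parentConfig G j x)

theorem parentIndicator_update [DecidableEq V] {G : Digraph V} {j w : V} (h : ¬ G.Adj w j)
    (c : ∀ u : {u : V // G.Adj u j}, X u) (x : ∀ v, X v) (a : X w) :
    parentIndicator G j c (Function.update x w a) = parentIndicator G j c x := by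
  rw [parentIndicator, parentConfig_update h, parentIndicator]

theorem parentIndicator_mul (G : Digraph V) (j : V) (c : ∀ u : {u : V // G.Adj u j}, X u)
    (f : (∀ u : {u : V // G.Adj u j}, X u) → ℝ) (x : ∀ v, X v) :
    parentIndicator G j c x * f (parentConfig G j x) = parentIndicator G j c x * f c := by
  by_cases h : parentConfig G j x = c <;> simp [parentIndicator, h]

end ParentIndicator

theorem card_inv_pos {V : Type*} {X : V → Type*} [∀ v, Fintype (X v)] [∀ v, Nonempty (X v)]
    (v : V) : 0 < (Fintype.card (X v) : ℝ)⁻¹ := by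
  have : 0 < Fintype.card (X v) := Fintype.card_pos
  positivity

theorem sum_card_inv {V : Type*} {X : V → Type*} [∀ v, Fintype (X v)] [∀ v, Nonempty (X v)]
    (v : V) : ∑ _a : X v, (Fintype.card (X v) : ℝ)⁻¹ = 1 := by
  have : (Fintype.card (X v) : ℝ) ≠ 0 := by exact_mod_cast Fintype.card_ne_zero
  simp [this]

/-- The uniform distribution on the configurations. -/
noncomputable def uniformPoint {V : Type*} [Fintype V] (X : V → Type*) [∀ v, Fintype (X v)] :
    (∀ v, X v) → ℝ :=
  fun _ => ∏ v, (Fintype.card (X v) : ℝ)⁻¹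

theorem uniformPoint_pos {V : Type*} [Fintype V] {X : V → Type*} [∀ v, Fintype (X v)]
    [∀ v, Nonempty (X v)] (x : ∀ v, X v) : 0 < uniformPoint X x :=
  Finset.prod_pos fun v _ => card_inv_pos v

section TangentSpace

variable {V : Type*} [Fintype V] [DecidableEq V] (X : V → Type*) [∀ v, Fintype (X v)]

/-- The functions `∑ v, F_v(x_v | x_pa(v))`, with `F_v(· | c)` of sum zero, scaled by the uniform
distribution. -/
noncomputable def interactionSpace (G : Digraph V) : Submodule ℝ ((∀ v, X v) → ℝ) where
  carrier := {h | ∃ F : Tables X G, (∀ v c, ∑ a, F v c a = 0) ∧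
    ∀ x, h x = uniformPoint X x * ∑ v, F v (parentConfig G v x) (x v)}
  add_mem' := by
    rintro h h' ⟨F, hF, hh⟩ ⟨F', hF', hh'⟩
    refine ⟨F + F', fun v c => ?_, fun x => ?_⟩
    · simp [Finset.sum_add_distrib, hF, hF']
    · simp [Finset.sum_add_distrib, hh, hh', mul_add]
  zero_mem' := ⟨0, by simp, by simp⟩
  smul_mem' := by
    rintro r h ⟨F, hF, hh⟩
    refine ⟨r • F, fun v c => ?_, fun x => ?_⟩
    · simp [← Finset.mul_sum, hF]
    · simp only [Pi.smul_apply, smul_eq_mul, hh, ← Finset.mul_sum]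
      ring

variable {X}

theorem edge_interaction_mem {G : Digraph V} {i k : V} (hik : G.Adj i k) (a : X i → ℝ)
    {b : X k → ℝ} (hb : ∑ s, b s = 0) :
    (fun x => uniformPoint X x * (a (x i) * b (x k))) ∈ interactionSpace X G := by
  refine ⟨Function.update 0 k fun c s => a (c ⟨i, hik⟩) * b s, fun v c => ?_, fun x => ?_⟩
  · rcases eq_or_ne v k with rfl | hv
    · simp [← Finset.mul_sum, hb]
    · simp [hv]
  · rw [Finset.sum_eq_single k]
    · simp [parentConfig]
    · intro v _ hv
      simp [hv]
    · simp

/-- The interaction is assigned to whichever endpoint is the child. Centring both functions makes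
either choice admissible, so the direction of the edge is invisible. -/
theorem joined_interaction_mem {G : Digraph V} {i k : V} (hik : G.Joined i k) {a : X i → ℝ}
    {b : X k → ℝ} (ha : ∑ s, a s = 0) (hb : ∑ s, b s = 0) :
    (fun x => uniformPoint X x * (a (x i) * b (x k))) ∈ interactionSpace X G := by
  rcases hik with h | h
  · exact edge_interaction_mem h a hb
  · simpa only [mul_comm (a _)] using edge_interaction_mem h b ha

variable [∀ v, Nonempty (X v)]

theorem prod_tables_mem_bayesNetModel {G : Digraph V} (hG : G.IsDAG) {κ : Tables X G}
    (hpos : ∀ v c a, 0 < κ v c a) (hκ : ∀ v c, ∑ a, κ v c a = 1) :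
    (fun x => ∏ v, κ v (parentConfig G v x) (x v)) ∈ bayesNetModel X G :=
  ⟨⟨fun _ => Finset.prod_pos fun v _ => hpos v _ _, sum_prod_tables hG hκ⟩, κ,
    fun v c a => (hpos v c a).le, hκ, fun _ => rfl⟩

theorem uniformPoint_mem_bayesNetModel {G : Digraph V} (hG : G.IsDAG) :
    uniformPoint X ∈ bayesNetModel X G :=
  prod_tables_mem_bayesNetModel hG (κ := fun v _ _ => (Fintype.card (X v) : ℝ)⁻¹)
    (fun v _ _ => card_inv_pos v) (fun v _ => sum_card_inv v)

theorem interactionSpace_subset_tangentCone {G : Digraph V} (hG : G.IsDAG) :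
    (interactionSpace X G : Set ((∀ v, X v) → ℝ)) ⊆
      modelTangentCone (bayesNetModel X G) (uniformPoint X) := by
  rintro h ⟨F, hF, hh⟩
  set u : V → ℝ := fun v => (Fintype.card (X v) : ℝ)⁻¹ with hu
  set ε : ℕ → ℝ := fun n => 1 / ((n : ℝ) + 1) with hε
  have hε0 : Tendsto ε atTop (𝓝 0) := tendsto_one_div_add_atTop_nhds_zero_nat
  -- The uniform tables are perturbed in the direction `F`. Centring of `F` keeps each table
  -- normalized, and positivity holds for large `n`.
  set κ : ℕ → Tables X G := fun n v c a => u v * (1 + ε n * F v c a) with hκ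
  have hlim : ∀ v c a, Tendsto (fun n => 1 + ε n * F v c a) atTop (𝓝 1) := fun v c a => by
    simpa using (hε0.mul_const (F v c a)).const_add 1
  have hpos : ∀ᶠ n in atTop, ∀ v c a, 0 < κ n v c a := by
    refine eventually_all.2 fun v => eventually_all.2 fun c => eventually_all.2 fun a => ?_
    filter_upwards [(hlim v c a).eventually (lt_mem_nhds zero_lt_one)] with n hn
    exact mul_pos (card_inv_pos v) hn
  have hsum : ∀ n v c, ∑ a, κ n v c a = 1 := fun n v c => by
    simp only [hκ, mul_add, mul_one, Finset.sum_add_distrib, ← Finset.mul_sum, hF, mul_zero,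
      add_zero]
    exact sum_card_inv v
  have hκlim : ∀ v c a, Tendsto (fun n => κ n v c a) atTop (𝓝 (u v)) := fun v c a => by
    simpa using (hlim v c a).const_mul (u v)
  refine mem_modelTangentCone_of_eventually (α := fun n => (n : ℝ) + 1)
    (t := fun n x => ∏ v, κ n v (parentConfig G v x) (x v))
    (Eventually.of_forall fun n => by positivity)
    (hpos.mono fun n hn => prod_tables_mem_bayesNetModel hG hn (hsum n)) ?_ ?_
  · exact tendsto_pi_nhds.2 fun x => tendsto_finsetProd _ fun v _ => hκlim v _ _
  · refine tendsto_pi_nhds.2 fun x => ?_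
    rw [hh]
    refine tendsto_mul_prod_sub_prod (fun v => hκlim v _ _) (fun v => ?_) Finset.univ
    refine tendsto_const_nhds.congr fun n => ?_
    have : (n : ℝ) + 1 ≠ 0 := by positivity
    simp only [hκ, hε]
    field_simp
    ring

/-! ### Conditional tables recovered from the joint distribution -/

theorem sum_mul_parentIndicator_pos (G : Digraph V) (j : V)
    (c : ∀ u : {u : V // G.Adj u j}, X u) {p : (∀ v, X v) → ℝ} (hp : ∀ x, 0 < p x) :
    0 < ∑ x, p x * parentIndicator G j c x := by
  classical
  refine Finset.sum_pos' (fun x _ => mul_nonneg (hp x).le ?_)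
    ⟨fun v => if h : G.Adj v j then c ⟨v, h⟩ else Classical.arbitrary _, Finset.mem_univ _, ?_⟩
  · rw [parentIndicator]
    exact Set.indicator_nonneg (fun _ _ => zero_le_one) _
  · refine mul_pos (hp _) ?_
    have hc : parentConfig G j (fun v => if h : G.Adj v j then c ⟨v, h⟩ else Classical.arbitrary _)
        = c := by
      funext u
      simp [parentConfig, u.2]
    simp [parentIndicator, hc]

/-- The event that the parents of `j` are in configuration `c` involves neither `j` nor its
descendants, so the residual is orthogonal to it. Thus `κ j c` is the conditional law of `X_j` given
this event. -/
theorem sum_mul_parentIndicator_residual {G : Digraph V} (hG : G.IsDAG) {κ : Tables X G}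
    (hκ : ∀ v c, ∑ a, κ v c a = 1) {p : (∀ v, X v) → ℝ}
    (hp : ∀ x, p x = ∏ v, κ v (parentConfig G v x) (x v)) (j : V)
    (c : ∀ u : {u : V // G.Adj u j}, X u) (g : X j → ℝ) :
    ∑ x, p x * parentIndicator G j c x * g (x j) =
      (∑ a, κ j c a * g a) * ∑ x, p x * parentIndicator G j c x := by
  have h := sum_prod_tables_mul_residual hG hκ j (parentIndicator G j c)
    (parentIndicator_update (hG.irrefl j) c)
    (fun w hw => parentIndicator_update (fun h => hG j (hw.tail h)) c) g
  simp only [← hp, mul_sub, parentIndicator_mul G j c (fun c => ∑ a, κ j c a * g a),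
    Finset.sum_sub_distrib, ← mul_assoc, ← Finset.sum_mul] at h
  linarith

theorem sum_uniformPoint_parentIndicator {G : Digraph V} (hG : G.IsDAG) (j : V)
    (c : ∀ u : {u : V // G.Adj u j}, X u) (g : X j → ℝ) :
    ∑ x, uniformPoint X x * parentIndicator G j c x * g (x j) =
      ((Fintype.card (X j) : ℝ)⁻¹ * ∑ a, g a) *
        ∑ x, uniformPoint X x * parentIndicator G j c x := by
  rw [Finset.mul_sum (f := g)]
  exact sum_mul_parentIndicator_residual hG (κ := fun v _ _ => (Fintype.card (X v) : ℝ)⁻¹)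
    (fun v _ => sum_card_inv v) (fun _ => rfl) j c g

/-- First order behaviour of conditional expectations given the parents of `j`. -/
theorem tendsto_table_expectation {G : Digraph V} (hG : G.IsDAG) {κ : ℕ → Tables X G}
    (hκ : ∀ n v c, ∑ a, κ n v c a = 1) {p : ℕ → (∀ v, X v) → ℝ} (hpos : ∀ n x, 0 < p n x)
    (hp : ∀ n x, p n x = ∏ v, κ n v (parentConfig G v x) (x v)) {α : ℕ → ℝ}
    {h : (∀ v, X v) → ℝ} (hlim : Tendsto p atTop (𝓝 (uniformPoint X)))
    (hder : Tendsto (fun n => α n • (p n - uniformPoint X)) atTop (𝓝 h)) (j : V)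
    (c : ∀ u : {u : V // G.Adj u j}, X u) (g : X j → ℝ) :
    Tendsto (fun n => ∑ a, κ n j c a * g a) atTop (𝓝 ((Fintype.card (X j) : ℝ)⁻¹ * ∑ a, g a)) ∧
    Tendsto (fun n => α n * (∑ a, κ n j c a * g a - (Fintype.card (X j) : ℝ)⁻¹ * ∑ a, g a)) atTop
      (𝓝 ((∑ x, h x * parentIndicator G j c x *
        (g (x j) - (Fintype.card (X j) : ℝ)⁻¹ * ∑ a, g a)) /
        ∑ x, uniformPoint X x * parentIndicator G j c x)) := by
  set m := (Fintype.card (X j) : ℝ)⁻¹ * ∑ a, g a with hm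
  have hden : Tendsto (fun n => ∑ x, p n x * parentIndicator G j c x) atTop
      (𝓝 (∑ x, uniformPoint X x * parentIndicator G j c x)) :=
    tendsto_finsetSum _ fun x _ => (tendsto_pi_nhds.1 hlim x).mul_const _
  have hden0 := (sum_mul_parentIndicator_pos G j c (uniformPoint_pos (X := X))).ne'
  have hdenn := fun n => (sum_mul_parentIndicator_pos G j c (hpos n)).ne'
  have hres := fun n => sum_mul_parentIndicator_residual hG (hκ n) (hp n) j c g
  have hunif := sum_uniformPoint_parentIndicator hG j c g
  rw [← hm] at hunif
  constructor
  · have hnum : Tendsto (fun n => ∑ x, p n x * parentIndicator G j c x * g (x j)) atTop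
        (𝓝 (∑ x, uniformPoint X x * parentIndicator G j c x * g (x j))) :=
      tendsto_finsetSum _ fun x _ => ((tendsto_pi_nhds.1 hlim x).mul_const _).mul_const _
    have := hnum.div hden hden0
    rw [hunif, mul_div_cancel_right₀ _ hden0] at this
    refine this.congr fun n => ?_
    rw [Pi.div_apply, hres, mul_div_cancel_right₀ _ (hdenn n)]
  · have hnum : Tendsto (fun n => ∑ x, (α n • (p n - uniformPoint X)) x *
        parentIndicator G j c x * (g (x j) - m)) atTop
        (𝓝 (∑ x, h x * parentIndicator G j c x * (g (x j) - m))) :=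
      tendsto_finsetSum _ fun x _ => ((tendsto_pi_nhds.1 hder x).mul_const _).mul_const _
    refine (hnum.div hden hden0).congr fun n => ?_
    rw [Pi.div_apply, div_eq_iff (hdenn n)]
    -- Subtracting `m` makes the contribution of the uniform distribution vanish, by `hunif`.
    have e1 : ∑ x, (α n • (p n - uniformPoint X)) x * parentIndicator G j c x * (g (x j) - m) =
        α n * ((∑ x, p n x * parentIndicator G j c x * g (x j) -
          m * ∑ x, p n x * parentIndicator G j c x) -
          (∑ x, uniformPoint X x * parentIndicator G j c x * g (x j) -
          m * ∑ x, uniformPoint X x * parentIndicator G j c x)) := by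
      simp only [Finset.mul_sum, ← Finset.sum_sub_distrib]
      refine Finset.sum_congr rfl fun x _ => ?_
      simp only [Pi.smul_apply, Pi.sub_apply, smul_eq_mul]
      ring
    rw [e1, hres, hunif]
    ring

/-- The tables are conditional expectations of `p n`, so convergence of the scaled differences of `p
n` forces that of the tables. The product rule then writes `h` as a sum of interactions. -/
theorem tangentCone_subset_interactionSpace {G : Digraph V} (hG : G.IsDAG) :
    modelTangentCone (bayesNetModel X G) (uniformPoint X) ⊆ interactionSpace X G := by
  classical
  rintro h ⟨α, p, -, hpM, hlim, hder⟩
  choose hpS κ hκ0 hκ hp using hpM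
  set u : V → ℝ := fun v => (Fintype.card (X v) : ℝ)⁻¹ with hu
  have hu0 : ∀ v, u v ≠ 0 := fun v => (card_inv_pos v).ne'
  -- For the indicator of the state `a`, the conditional expectation is a single table entry.
  have key := fun j c (a : X j) => tendsto_table_expectation hG hκ (fun n => (hpS n).1) hp hlim hder
    j c (Pi.single a 1)
  simp only [Pi.single_apply, mul_ite, mul_one, mul_zero, Finset.sum_ite_eq', Finset.mem_univ,
    if_true] at key
  choose hκlim hκder using key
  refine ⟨fun j c a => (u j)⁻¹ * ((∑ x, h x * parentIndicator G j c x *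
        ((if x j = a then 1 else 0) - u j)) /
        ∑ x, uniformPoint X x * parentIndicator G j c x), fun j c => ?_, fun x => ?_⟩
  · rw [← Finset.mul_sum]
    refine mul_eq_zero_of_right _ (tendsto_nhds_unique
      (tendsto_finsetSum Finset.univ fun a _ => hκder j c a) ?_)
    refine tendsto_const_nhds.congr fun n => ?_
    rw [← Finset.mul_sum, Finset.sum_sub_distrib, hκ, sum_card_inv, sub_self, mul_zero]
  · refine tendsto_nhds_unique (tendsto_pi_nhds.1 hder x) ?_
    refine (tendsto_mul_prod_sub_prod (u := u)
      (κ := fun n v => κ n v (parentConfig G v x) (x v)) (α := α)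
      (fun v => hκlim v _ _) (fun v => ?_) Finset.univ).congr fun n => ?_
    · rw [mul_inv_cancel_left₀ (hu0 v)]
      exact hκder v _ _
    · simp only [Pi.smul_apply, Pi.sub_apply, smul_eq_mul, hp, uniformPoint]
      rfl

theorem modelTangentCone_bayesNetModel {G : Digraph V} (hG : G.IsDAG) :
    modelTangentCone (bayesNetModel X G) (uniformPoint X) = interactionSpace X G :=
  (tangentCone_subset_interactionSpace hG).antisymm (interactionSpace_subset_tangentCone hG)

end TangentSpace

/-! ### Overlap at the uniform distribution -/

/-- The sum of the interactions `a(x_i) b(x_k)` and `c(x_j) b(x_k)`, scaled by the uniform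
distribution. -/
noncomputable def pairInteraction {V : Type*} [Fintype V] {X : V → Type*} [∀ v, Fintype (X v)]
    {i j k : V} (a : X i → ℝ) (c : X j → ℝ) (b : X k → ℝ) : (∀ v, X v) → ℝ :=
  fun x => uniformPoint X x * ((a (x i) + c (x j)) * b (x k))

theorem pairInteraction_comm {V : Type*} [Fintype V] {X : V → Type*} [∀ v, Fintype (X v)]
    {i j k : V} (a : X i → ℝ) (c : X j → ℝ) (b : X k → ℝ) :
    pairInteraction a c b = pairInteraction c a b := by
  funext x
  simp only [pairInteraction, add_comm (a _)]

/-- Of any two vertices, one is not a descendant of the other. -/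
theorem Digraph.IsDAG.not_transGen_or {V : Type*} {G : Digraph V} (hG : G.IsDAG) (i j : V) :
    ¬ Relation.TransGen G.Adj j i ∨ ¬ Relation.TransGen G.Adj i j := by
  by_contra! h
  exact hG j (h.1.trans h.2)

section Overlap

variable {V : Type*} [Fintype V] [DecidableEq V] {X : V → Type*} [∀ v, Fintype (X v)]

theorem pairInteraction_mem {G : Digraph V} {i j k : V} (hik : G.Joined i k) (hjk : G.Joined j k)
    {a : X i → ℝ} {c : X j → ℝ} {b : X k → ℝ} (ha : ∑ s, a s = 0) (hc : ∑ s, c s = 0)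
    (hb : ∑ s, b s = 0) : pairInteraction a c b ∈ interactionSpace X G := by
  convert (interactionSpace X G).add_mem (joined_interaction_mem hik ha hb)
    (joined_interaction_mem hjk hc hb) using 1
  funext x
  simp only [pairInteraction, Pi.add_apply]
  ring

variable [∀ v, Nonempty (X v)]

/-- Second order behaviour of a covariance between `X_j` and a nondescendant `X_i` that is not a
parent of `j`. -/
theorem tendsto_sq_mul_covariance {G : Digraph V} (hG : G.IsDAG) {i j : V} (hij : i ≠ j)
    (hadj : ¬ G.Adj i j) (hdesc : ¬ Relation.TransGen G.Adj j i) {a : X i → ℝ} {c : X j → ℝ}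
    (ha : ∑ s, a s = 0) (hc : ∑ s, c s = 0) {p : ℕ → (∀ v, X v) → ℝ}
    (hp : ∀ n, p n ∈ bayesNetModel X G) {α : ℕ → ℝ} {h : (∀ v, X v) → ℝ}
    (hlim : Tendsto p atTop (𝓝 (uniformPoint X)))
    (hder : Tendsto (fun n => α n • (p n - uniformPoint X)) atTop (𝓝 h)) :
    Tendsto (fun n => α n ^ 2 * ∑ x, p n x * (a (x i) * c (x j))) atTop
      (𝓝 (∑ x, h x * (a (x i) *
        ((∑ y, h y * parentIndicator G j (parentConfig G j x) y * c (y j)) /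
          ∑ y, uniformPoint X y * parentIndicator G j (parentConfig G j x) y)))) := by
  choose hpS κ hκ0 hκ hpκ using hp
  -- `m n` is the conditional mean of `c(X_j)` given the parents of `j`. It replaces `c(X_j)` under
  -- `p n` by the Markov property, and is orthogonal to `a(X_i)` under the uniform distribution
  -- because `i` is not a parent of `j`. The mean of `a(X_i) c(X_j)` is therefore a sum of products
  -- of two first-order quantities.
  set m : ℕ → (∀ v, X v) → ℝ := fun n x => ∑ s, κ n j (parentConfig G j x) s * c s with hm
  have hmlim : ∀ x, Tendsto (fun n => α n * m n x) atTop
      (𝓝 ((∑ y, h y * parentIndicator G j (parentConfig G j x) y * c (y j)) /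
          ∑ y, uniformPoint X y * parentIndicator G j (parentConfig G j x) y)) := by
    intro x
    have := (tendsto_table_expectation hG hκ (fun n => (hpS n).1) hpκ hlim hder j
      (parentConfig G j x) c).2
    simpa only [hc, mul_zero, sub_zero] using this
  have hcov : ∀ n, ∑ x, p n x * (a (x i) * c (x j)) = ∑ x, p n x * (a (x i) * m n x) := by
    intro n
    have := sum_prod_tables_mul_residual hG (hκ n) j (fun x => a (x i))
      (fun x s => by rw [Function.update_of_ne hij])
      (fun w hw x s => by
        rw [Function.update_of_ne]
        rintro rfl
        exact hdesc hw) c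
    have hpκ' : ∀ x, p n x = ∏ v, κ n v (parentConfig G v x) (x v) := hpκ n
    simp only [← hpκ', mul_sub, Finset.sum_sub_distrib] at this
    exact sub_eq_zero.1 this
  have huni : ∀ n, ∑ x, uniformPoint X x * (a (x i) * m n x) = 0 := by
    intro n
    have := sum_mul_eq_zero_of_fiber_sum (X := X) i (H := fun x => uniformPoint X x * m n x)
      (q := fun x => a (x i))
      (fun x s => by simp only [hm, parentConfig_update hadj, uniformPoint])
      (fun x => by simp only [Function.update_self, ha])
    rw [← this]
    exact Finset.sum_congr rfl fun x _ => by ring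
  refine (tendsto_finsetSum Finset.univ fun x _ =>
    (tendsto_pi_nhds.1 hder x).mul ((hmlim x).const_mul (a (x i)))).congr fun n => ?_
  calc ∑ x, (α n • (p n - uniformPoint X)) x * (a (x i) * (α n * m n x))
      = α n ^ 2 * (∑ x, p n x * (a (x i) * m n x) -
          ∑ x, uniformPoint X x * (a (x i) * m n x)) := by
        rw [← Finset.sum_sub_distrib, Finset.mul_sum]
        refine Finset.sum_congr rfl fun x _ => ?_
        simp only [Pi.smul_apply, Pi.sub_apply, smul_eq_mul]
        ring
    _ = _ := by rw [huni, hcov, sub_zero]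

/-- Since `k` is not a parent of `j`, averaging over `x k` kills the factor `b`: the conditional
mean of `c(X_j)` has no first-order change. -/
theorem tendsto_covariance_of_collider {G : Digraph V} (hG : G.IsDAG) {i j k : V} (hij : i ≠ j)
    (hadj : ¬ G.Adj i j) (hdesc : ¬ Relation.TransGen G.Adj j i) (hik : G.Adj i k)
    (hjk : G.Adj j k) {a : X i → ℝ} {c : X j → ℝ} {b : X k → ℝ} (ha : ∑ s, a s = 0)
    (hc : ∑ s, c s = 0) (hb : ∑ s, b s = 0) {p : ℕ → (∀ v, X v) → ℝ}
    (hp : ∀ n, p n ∈ bayesNetModel X G) {α : ℕ → ℝ}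
    (hlim : Tendsto p atTop (𝓝 (uniformPoint X)))
    (hder : Tendsto (fun n => α n • (p n - uniformPoint X)) atTop
      (𝓝 (pairInteraction a c b))) :
    Tendsto (fun n => α n ^ 2 * ∑ x, p n x * (a (x i) * c (x j))) atTop (𝓝 0) := by
  have hik' : i ≠ k := fun h => hG.irrefl k (h ▸ hik)
  have hjk' : j ≠ k := fun h => hG.irrefl k (h ▸ hjk)
  have hkj : ¬ G.Adj k j := fun h => hG j (.tail (.single hjk) h)
  have hz : ∀ x, ∑ y, pairInteraction a c b y * parentIndicator G j (parentConfig G j x) y *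
      c (y j) = 0 := by
    intro x
    have := sum_mul_eq_zero_of_fiber_sum (X := X) k
      (H := fun y => uniformPoint X y * (a (y i) + c (y j)) *
        parentIndicator G j (parentConfig G j x) y * c (y j)) (q := fun y => b (y k))
      (fun y s => by
        simp only [parentIndicator_update hkj, Function.update_of_ne hik',
          Function.update_of_ne hjk', uniformPoint])
      (fun y => by simp only [Function.update_self, hb])
    rw [← this]
    exact Finset.sum_congr rfl fun y _ => by simp only [pairInteraction]; ring
  simpa only [hz, zero_div, mul_zero, Finset.sum_const_zero] using
    tendsto_sq_mul_covariance hG hij hadj hdesc ha hc hp hlim hder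

/-- Since `k` is a parent of `j`, the conditional mean of `c(X_j)` changes to first order by `b(x_k)
σ`. Pairing this with the term `a(x_i) b(x_k)` of the tangent vector leaves `σ` times the uniform
mean of `a² b²`. -/
theorem tendsto_covariance_of_parent {G : Digraph V} (hG : G.IsDAG) {i j k : V} (hij : i ≠ j)
    (hik : i ≠ k) (hadj : ¬ G.Adj i j) (hdesc : ¬ Relation.TransGen G.Adj j i) (hkj : G.Adj k j)
    {a : X i → ℝ} {c : X j → ℝ} {b : X k → ℝ} (ha : ∑ s, a s = 0) (hc : ∑ s, c s = 0)
    (ha0 : ∃ s, a s ≠ 0) (hc0 : ∃ s, c s ≠ 0) (hb0 : ∃ s, b s ≠ 0) {p : ℕ → (∀ v, X v) → ℝ}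
    (hp : ∀ n, p n ∈ bayesNetModel X G) {α : ℕ → ℝ}
    (hlim : Tendsto p atTop (𝓝 (uniformPoint X)))
    (hder : Tendsto (fun n => α n • (p n - uniformPoint X)) atTop
      (𝓝 (pairInteraction a c b))) :
    ∃ L, 0 < L ∧
      Tendsto (fun n => α n ^ 2 * ∑ x, p n x * (a (x i) * c (x j))) atTop (𝓝 L) := by
  have hkj' : k ≠ j := fun h => hG.irrefl j (h ▸ hkj)
  -- The variance of `c(X_j)` under the uniform distribution.
  set σ : ℝ := (Fintype.card (X j) : ℝ)⁻¹ * ∑ s, c s ^ 2 with hσ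
  have hσ0 : 0 < σ := by
    obtain ⟨s, hs⟩ := hc0
    exact mul_pos (card_inv_pos j) (Finset.sum_pos' (fun _ _ => sq_nonneg _)
      ⟨s, Finset.mem_univ s, by positivity⟩)
  have hΛ : ∀ x, ((∑ y, pairInteraction a c b y * parentIndicator G j (parentConfig G j x) y *
      c (y j)) / ∑ y, uniformPoint X y * parentIndicator G j (parentConfig G j x) y) =
      b (x k) * σ := by
    intro x
    rw [div_eq_iff (sum_mul_parentIndicator_pos G j _ uniformPoint_pos).ne']
    set w := parentIndicator G j (parentConfig G j x) with hw
    have h1 : ∑ y, uniformPoint X y * w y * c (y j) * a (y i) = 0 :=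
      sum_mul_eq_zero_of_fiber_sum (X := X) i
        (H := fun y => uniformPoint X y * w y * c (y j)) (q := fun y => a (y i))
        (fun y s => by
          simp only [hw, parentIndicator_update hadj, Function.update_of_ne hij.symm, uniformPoint])
        (fun y => by simp only [Function.update_self, ha])
    have h2 : ∑ y, uniformPoint X y * w y * c (y j) ^ 2 = σ * ∑ y, uniformPoint X y * w y :=
      sum_mul_of_fiber_sum (X := X) j (H := fun y => uniformPoint X y * w y)
        (q := fun y => c (y j) ^ 2)
        (fun y s => by simp only [hw, parentIndicator_update (hG.irrefl j), uniformPoint])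
        (fun y => by simp only [Function.update_self])
    have h3 : ∀ y, w y * b (y k) = w y * b (x k) := fun y =>
      parentIndicator_mul G j (parentConfig G j x) (fun z => b (z ⟨k, hkj⟩)) y
    calc ∑ y, pairInteraction a c b y * w y * c (y j)
        = ∑ y, b (x k) * (uniformPoint X y * w y * c (y j) * a (y i) +
            uniformPoint X y * w y * c (y j) ^ 2) := by
          refine Finset.sum_congr rfl fun y _ => ?_
          simp only [pairInteraction]
          linear_combination uniformPoint X y * (a (y i) + c (y j)) * c (y j) * h3 y
      _ = b (x k) * σ * ∑ y, uniformPoint X y * w y := by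
          rw [← Finset.mul_sum, Finset.sum_add_distrib, h1, h2]
          ring
  have hlim' := tendsto_sq_mul_covariance hG hij hadj hdesc ha hc hp hlim hder
  simp only [hΛ] at hlim'
  refine ⟨_, ?_, hlim'⟩
  have h1 : ∑ x, uniformPoint X x * a (x i) * b (x k) ^ 2 * σ * c (x j) = 0 :=
    sum_mul_eq_zero_of_fiber_sum (X := X) j
      (H := fun x => uniformPoint X x * a (x i) * b (x k) ^ 2 * σ) (q := fun x => c (x j))
      (fun y s => by
        simp only [Function.update_of_ne hij, Function.update_of_ne hkj', uniformPoint])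
      (fun y => by simp only [Function.update_self, hc])
  have h2 : ∑ x, pairInteraction a c b x * (a (x i) * (b (x k) * σ)) =
      ∑ x, uniformPoint X x * (a (x i) ^ 2 * b (x k) ^ 2 * σ) := by
    rw [← add_zero (∑ x, uniformPoint X x * (a (x i) ^ 2 * b (x k) ^ 2 * σ)), ← h1,
      ← Finset.sum_add_distrib]
    refine Finset.sum_congr rfl fun y _ => ?_
    simp only [pairInteraction]
    ring
  rw [h2]
  obtain ⟨s, hs⟩ := ha0
  obtain ⟨t, ht⟩ := hb0
  refine Finset.sum_pos' (fun x _ => mul_nonneg (uniformPoint_pos x).le (by positivity))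
    ⟨Function.update (Function.update (fun _ => Classical.arbitrary _) k t) i s,
      Finset.mem_univ _, mul_pos (uniformPoint_pos _) ?_⟩
  rw [Function.update_self, Function.update_of_ne hik.symm, Function.update_self]
  positivity

theorem tendsto_covariance_of_unshieldedCollider {G : Digraph V} (hG : G.IsDAG) {i j k : V}
    (hcol : G.UnshieldedCollider i k j) {a : X i → ℝ} {c : X j → ℝ} {b : X k → ℝ}
    (ha : ∑ s, a s = 0) (hc : ∑ s, c s = 0) (hb : ∑ s, b s = 0) {p : ℕ → (∀ v, X v) → ℝ}
    (hp : ∀ n, p n ∈ bayesNetModel X G) {α : ℕ → ℝ}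
    (hlim : Tendsto p atTop (𝓝 (uniformPoint X)))
    (hder : Tendsto (fun n => α n • (p n - uniformPoint X)) atTop
      (𝓝 (pairInteraction a c b))) :
    Tendsto (fun n => α n ^ 2 * ∑ x, p n x * (a (x i) * c (x j))) atTop (𝓝 0) := by
  obtain ⟨hij, hnj, hik, hjk⟩ := hcol
  rcases hG.not_transGen_or i j with hd | hd
  · exact tendsto_covariance_of_collider hG hij (fun h => hnj (.inl h)) hd hik hjk ha hc hb hp
      hlim hder
  · rw [pairInteraction_comm] at hder
    simp only [mul_comm (a _)]
    exact tendsto_covariance_of_collider hG hij.symm (fun h => hnj (.inr h)) hd hjk hik hc ha hb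
      hp hlim hder

theorem tendsto_covariance_of_unshieldedNoncollider {G : Digraph V} (hG : G.IsDAG) {i j k : V}
    (hnon : G.UnshieldedNoncollider i k j) {a : X i → ℝ} {c : X j → ℝ} {b : X k → ℝ}
    (ha : ∑ s, a s = 0) (hc : ∑ s, c s = 0) (ha0 : ∃ s, a s ≠ 0) (hc0 : ∃ s, c s ≠ 0)
    (hb0 : ∃ s, b s ≠ 0) {p : ℕ → (∀ v, X v) → ℝ} (hp : ∀ n, p n ∈ bayesNetModel X G) {α : ℕ → ℝ}
    (hlim : Tendsto p atTop (𝓝 (uniformPoint X)))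
    (hder : Tendsto (fun n => α n • (p n - uniformPoint X)) atTop
      (𝓝 (pairInteraction a c b))) :
    ∃ L, 0 < L ∧
      Tendsto (fun n => α n ^ 2 * ∑ x, p n x * (a (x i) * c (x j))) atTop (𝓝 L) := by
  obtain ⟨hij, hnj, hik, hjk, hncol⟩ := hnon
  have hik' : i ≠ k := by
    rintro rfl
    exact hik.elim (hG.irrefl i) (hG.irrefl i)
  have hjk' : j ≠ k := by
    rintro rfl
    exact hjk.elim (hG.irrefl j) (hG.irrefl j)
  rcases hG.not_transGen_or i j with hd | hd
  -- If `j → k`, then `i → k` would give a collider and `k → i` would make `i` a descendant of `j`.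
  · have hkj : G.Adj k j := hjk.resolve_left fun hjk =>
      hik.elim (fun hik => hncol ⟨hik, hjk⟩) fun hki => hd (.tail (.single hjk) hki)
    exact tendsto_covariance_of_parent hG hij hik' (fun h => hnj (.inl h)) hd hkj ha hc ha0 hc0
      hb0 hp hlim hder
  · have hki : G.Adj k i := hik.resolve_left fun hik =>
      hjk.elim (fun hjk => hncol ⟨hik, hjk⟩) fun hkj => hd (.tail (.single hik) hkj)
    rw [pairInteraction_comm] at hder
    simp only [mul_comm (a _)]
    exact tendsto_covariance_of_parent hG hij.symm hjk' (fun h => hnj (.inr h)) hd hki hc ha hc0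
      ha0 hb0 hp hlim hder

end Overlap

theorem exists_centred_ne_zero (S : Type*) [Fintype S] [Nontrivial S] :
    ∃ a : S → ℝ, ∑ s, a s = 0 ∧ ∃ s, a s ≠ 0 := by
  classical
  obtain ⟨s, t, hst⟩ := exists_pair_ne S
  refine ⟨Pi.single s 1 - Pi.single t 1, by simp, s, ?_⟩
  simp [hst]

theorem overlapAt_uniformPoint {V : Type*} [Fintype V] [DecidableEq V] {X : V → Type*}
    [∀ v, Fintype (X v)] [∀ v, Nontrivial (X v)] {G₁ G₂ : Digraph V} {i j k : V}
    (hG₁ : G₁.IsDAG) (hG₂ : G₂.IsDAG) (hcol : G₁.UnshieldedCollider i k j)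
    (hnon : G₂.UnshieldedNoncollider i k j) :
    OverlapAt (bayesNetModel X G₁) (bayesNetModel X G₂) (uniformPoint X) := by
  obtain ⟨a, ha, ha0⟩ := exists_centred_ne_zero (X i)
  obtain ⟨c, hc, hc0⟩ := exists_centred_ne_zero (X j)
  obtain ⟨b, hb, hb0⟩ := exists_centred_ne_zero (X k)
  refine ⟨⟨uniformPoint_mem_bayesNetModel hG₁, uniformPoint_mem_bayesNetModel hG₂⟩,
    pairInteraction a c b, ⟨?_, ?_⟩, ?_⟩
  · exact interactionSpace_subset_tangentCone hG₁
      (pairInteraction_mem (.inl hcol.2.2.1) (.inl hcol.2.2.2) ha hc hb)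
  · exact interactionSpace_subset_tangentCone hG₂
      (pairInteraction_mem hnon.2.2.1 hnon.2.2.2.1 ha hc hb)
  · rintro ⟨α, p, -, hp, hlim, hder⟩
    obtain ⟨L, hL, hL'⟩ := tendsto_covariance_of_unshieldedNoncollider hG₂ hnon ha hc ha0 hc0 hb0
      (fun n => (hp n).2) hlim hder
    exact hL.ne' (tendsto_nhds_unique hL' (tendsto_covariance_of_unshieldedCollider hG₁ hcol
      ha hc hb (fun n => (hp n).1) hlim hder))

/-! ### Overlap excludes simultaneous convexity -/

/-- Density forces full affine span, hence nonempty interior, and such a convex set has the same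
interior as its closure. -/
theorem Convex.eq_univ_of_dense {E : Type*} [NormedAddCommGroup E] [NormedSpace ℝ E]
    [FiniteDimensional ℝ E] {K : Set E} (hK : Convex ℝ K) (hd : Dense K) : K = Set.univ := by
  have hspan : affineSpan ℝ K = ⊤ := by
    have hcl : IsClosed (affineSpan ℝ K : Set E) :=
      AffineSubspace.closed_of_finiteDimensional _
    have := (hd.mono (subset_affineSpan ℝ K)).closure_eq
    rw [hcl.closure_eq] at this
    exact SetLike.coe_injective this
  have hne := hK.interior_nonempty_iff_affineSpan_eq_top.2 hspan
  have hint := hK.interior_closure_eq_interior_of_nonempty_interior hne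
  rw [hd.closure_eq, interior_univ] at hint
  exact Set.univ_subset_iff.1 (hint ▸ interior_subset)

theorem modelTangentCone_inter_of_mem_nhds {E : Type*} [AddCommGroup E] [Module ℝ E]
    [TopologicalSpace E] {C N : Set E} {η : E} (hN : N ∈ 𝓝 η) :
    modelTangentCone (C ∩ N) η = modelTangentCone C η := by
  refine Set.Subset.antisymm ?_ ?_
  · rintro h ⟨α, t, hα, ht, h1, h2⟩
    exact ⟨α, t, hα, fun n => (ht n).1, h1, h2⟩
  · rintro h ⟨α, t, hα, ht, h1, h2⟩
    exact mem_modelTangentCone_of_eventually (.of_forall hα)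
      ((h1.eventually hN).mono fun n hn => ⟨ht n, hn⟩) h1 h2

theorem tendsto_smul_line_sub {E : Type*} [NormedAddCommGroup E] [NormedSpace ℝ E] (η k : E)
    {ε : ℝ} (hε : 0 < ε) :
    Tendsto (fun n : ℕ => η + (ε * (1 / ((n : ℝ) + 1))) • k) atTop (𝓝 η) ∧
    Tendsto (fun n : ℕ => (((n : ℝ) + 1) / ε) • (η + (ε * (1 / ((n : ℝ) + 1))) • k - η)) atTop
      (𝓝 k) := by
  constructor
  · simpa using ((tendsto_one_div_add_atTop_nhds_zero_nat.const_mul ε).smul_const k).const_add η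
  · refine tendsto_const_nhds.congr fun n => ?_
    have : (n : ℝ) + 1 ≠ 0 := by positivity
    rw [add_sub_cancel_left, smul_smul]
    field_simp
    simp

theorem Convex.line_mem {E : Type*} [AddCommGroup E] [Module ℝ E] {C : Set E}
    (hC : Convex ℝ C) {η k : E} (hη : η ∈ C) {ε δ : ℝ} (hε : 0 < ε) (hk : η + ε • k ∈ C)
    (hδ : 0 ≤ δ) (hδε : δ ≤ ε) : η + δ • k ∈ C := by
  have := hC.add_smul_mem hη hk (t := δ / ε) ⟨by positivity, (div_le_one hε).2 hδε⟩
  rwa [smul_smul, div_mul_cancel₀ _ hε.ne'] at this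

/-- A convex set whose tangent cone is a linear subspace contains a segment in each tangent
direction. -/
theorem Convex.exists_add_smul_mem {E : Type*} [NormedAddCommGroup E] [NormedSpace ℝ E]
    [FiniteDimensional ℝ E] {C : Set E} (hC : Convex ℝ C) {η : E} (hη : η ∈ C)
    (L : Submodule ℝ E) (hL : modelTangentCone C η = L) {k : E} (hk : k ∈ L) :
    ∃ ε : ℝ, 0 < ε ∧ η + ε • k ∈ C := by
  have hsub : ∀ c ∈ C, c - η ∈ L := by
    intro c hc
    rw [← SetLike.mem_coe, ← hL]
    obtain ⟨h1, h2⟩ := tendsto_smul_line_sub η (c - η) one_pos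
    refine ⟨_, _, fun n => by positivity, fun n => ?_, h1, h2⟩
    refine hC.line_mem hη one_pos (by simpa using hc) (by positivity) ?_
    rw [one_mul, div_le_one (by positivity)]
    linarith [n.cast_nonneg (α := ℝ)]
  -- The feasible directions are convex, by shrinking to a common step, and dense in `L`, because
  -- they contain every `α n • (t n - η)`. Hence they fill `L`.
  set K : Set L := {l | ∃ ε : ℝ, 0 < ε ∧ η + ε • (l : E) ∈ C} with hK
  have hconv : Convex ℝ K := by
    rintro x ⟨ε, hε, hx⟩ y ⟨δ, hδ, hy⟩ s t hs ht hst
    have hm : 0 < min ε δ := lt_min hε hδ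
    refine ⟨min ε δ, hm, ?_⟩
    have := hC (hC.line_mem hη hε hx hm.le (min_le_left _ _))
      (hC.line_mem hη hδ hy hm.le (min_le_right _ _)) hs ht hst
    convert this using 1
    have hη' : η = s • η + t • η := by rw [← add_smul, hst, one_smul]
    simp only [Submodule.coe_add, Submodule.coe_smul, smul_add]
    nth_rw 1 [hη']
    rw [smul_comm (min ε δ) s, smul_comm (min ε δ) t]
    abel
  have hdense : Dense K := by
    rintro ⟨l, hl⟩
    have hl' := hl
    rw [← SetLike.mem_coe, ← hL] at hl'
    obtain ⟨α, t, hα, ht, -, h2⟩ := hl'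
    refine mem_closure_of_tendsto
      (f := fun n => (⟨α n • (t n - η), L.smul_mem _ (hsub _ (ht n))⟩ : L))
      (tendsto_subtype_rng.2 h2) (.of_forall fun n => ⟨(α n)⁻¹, inv_pos.2 (hα n), ?_⟩)
    simpa [smul_smul, (hα n).ne'] using ht n
  have : (⟨k, hk⟩ : L) ∈ K := hconv.eq_univ_of_dense hdense ▸ Set.mem_univ _
  exact this

/-- With `P` a left inverse of `f'`, the map `P ∘ ψ` is locally invertible at `η`, which lifts
points of `M` near `ψ η` to parameters. The hypothesis `hM` ensures that the lift is exact: `P` is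
injective on the range of `f'`, where `ψ s - t` lies. -/
theorem modelTangentCone_preimage {E F : Type*} [NormedAddCommGroup E] [NormedSpace ℝ E]
    [FiniteDimensional ℝ E] [NormedAddCommGroup F] [NormedSpace ℝ F] [FiniteDimensional ℝ F]
    {ψ : E → F} {f' : E →L[ℝ] F} {η : E} (hψ : HasStrictFDerivAt ψ f' η)
    (hinj : Function.Injective f') {Θ : Set E} (hΘ : Θ ∈ 𝓝 η) {M : Set F}
    (hM : ∀ s ∈ Θ, ∀ t ∈ M, ψ s - t ∈ f'.range) :
    modelTangentCone (Θ ∩ ψ ⁻¹' M) η = f' ⁻¹' modelTangentCone M (ψ η) := by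
  refine Set.Subset.antisymm ?_ ?_
  · rintro k ⟨α, s, hα, hs, h1, h2⟩
    have hd : Tendsto (fun n => s n - η) atTop (𝓝 0) := by simpa using h1.sub_const η
    refine ⟨α, fun n => ψ (s n), hα, fun n => (hs n).2,
      hψ.hasFDerivAt.continuousAt.tendsto.comp h1, ?_⟩
    simpa using hψ.hasFDerivAt.hasFDerivWithinAt (s := Set.univ) |>.lim hd
      (.of_forall fun _ => Set.mem_univ _) h2
  · rintro k ⟨α, t, hα, ht, h1, h2⟩
    obtain ⟨P₀, hP₀⟩ := LinearMap.exists_leftInverse_of_injective (f' : E →ₗ[ℝ] F)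
      (LinearMap.ker_eq_bot.2 hinj)
    set P : F →L[ℝ] E := LinearMap.toContinuousLinearMap P₀ with hP
    have hPf : ∀ z, P (f' z) = z := fun z => LinearMap.congr_fun hP₀ z
    have hΦ : HasStrictFDerivAt (fun s => P (ψ s))
        ((ContinuousLinearEquiv.refl ℝ E : E ≃L[ℝ] E) : E →L[ℝ] E) η := by
      convert P.hasStrictFDerivAt.comp η hψ using 1
      ext z
      exact congrArg _ (hPf z).symm
    set g := hΦ.localInverse (fun s => P (ψ s)) _ η with hg
    have hPt : Tendsto (fun n => P (t n)) atTop (𝓝 (P (ψ η))) :=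
      (P.continuous.tendsto _).comp h1
    have hs : Tendsto (fun n => g (P (t n))) atTop (𝓝 η) := hΦ.localInverse_tendsto.comp hPt
    refine mem_modelTangentCone_of_eventually (.of_forall hα) (t := fun n => g (P (t n)))
      ?_ hs ?_
    · filter_upwards [hPt.eventually hΦ.eventually_right_inverse, hs.eventually hΘ] with n hn hnΘ
      obtain ⟨z, hz⟩ := hM _ hnΘ _ (ht n)
      have hz' : f' z = ψ (g (P (t n))) - t n := hz
      have h0 : z = 0 := by
        rw [← hPf z, hz', map_sub, sub_eq_zero]
        exact hn
      rw [h0, map_zero] at hz'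
      refine ⟨hnΘ, ?_⟩
      rw [Set.mem_preimage, sub_eq_zero.1 hz'.symm]
      exact ht n
    · have hgd := hΦ.to_localInverse.hasFDerivAt.hasFDerivWithinAt (s := Set.univ)
      have hd : Tendsto (fun n => P (t n) - P (ψ η)) atTop (𝓝 0) := by
        simpa using hPt.sub_const (P (ψ η))
      have hc : Tendsto (fun n => α n • (P (t n) - P (ψ η))) atTop (𝓝 k) := by
        have := (P.continuous.tendsto _).comp h2
        rw [hPf] at this
        refine this.congr fun n => ?_
        simp
      have hgη : g (P (ψ η)) = η := hΦ.localInverse_apply_image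
      have := hgd.lim hd (.of_forall fun _ => Set.mem_univ _) hc
      simpa [← hg, hgη] using this

/-- The range lies in the hyperplane of vectors of sum zero and has the same dimension `|S| - 1`. -/
theorem mem_range_of_sum_eq_zero {S : Type*} [Fintype S] [Nonempty S] {E : Type*} [AddCommGroup E]
    [Module ℝ E] {f : E →ₗ[ℝ] S → ℝ} [FiniteDimensional ℝ E]
    (hE : Module.finrank ℝ E = Fintype.card S - 1) (hf : Function.Injective f)
    (h0 : ∀ z, ∑ s, f z s = 0) {y : S → ℝ} (hy : ∑ s, y s = 0) : y ∈ f.range := by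
  classical
  set σ : (S → ℝ) →ₗ[ℝ] ℝ := ∑ s, LinearMap.proj s with hσ
  have hσapp : ∀ y, σ y = ∑ s, y s := fun y => by simp [hσ]
  have hle : f.range ≤ σ.ker := by
    rintro _ ⟨z, rfl⟩
    rw [LinearMap.mem_ker, hσapp, h0]
  have hsurj : σ.range = ⊤ := by
    refine LinearMap.range_eq_top.2 fun r => ⟨Pi.single (Classical.arbitrary S) r, ?_⟩
    rw [hσapp]
    simp
  have hker := σ.finrank_range_add_finrank_ker
  rw [hsurj, finrank_top, Module.finrank_self, Module.finrank_fintype_fun_eq_card] at hker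
  have := Submodule.eq_of_le_of_finrank_eq hle (by
    rw [LinearMap.finrank_range_of_inj hf]
    omega)
  rw [this, LinearMap.mem_ker, hσapp, hy]

theorem OverlapAt.not_simultaneouslyConvexNear {S : Type*} [Fintype S] [Nonempty S]
    {𝓜 : Set (Set (S → ℝ))} {M₁ M₂ : Set (S → ℝ)} {θ : S → ℝ} (hM₁ : M₁ ∈ 𝓜) (hM₂ : M₂ ∈ 𝓜)
    (hS₁ : M₁ ⊆ openSimplex S) (hS₂ : M₂ ⊆ openSimplex S) (L₁ L₂ : Submodule ℝ (S → ℝ))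
    (hL₁ : modelTangentCone M₁ θ = L₁) (hL₂ : modelTangentCone M₂ θ = L₂)
    (hov : OverlapAt M₁ M₂ θ) : ¬ SimultaneouslyConvexNear 𝓜 θ := by
  rintro ⟨W, Θ, ψ, -, hψ, η, hη, rfl, hconv⟩
  obtain ⟨⟨hθ₁, hθ₂⟩, h, ⟨hh₁, hh₂⟩, hh⟩ := hov
  have hΘ : Θ ∈ 𝓝 η := hψ.isOpen.mem_nhds hη
  set f' := fderiv ℝ ψ η with hf'
  have hinj : Function.Injective f' := hψ.full_rank η hη
  -- Twice differentiability makes the derivative continuous at `η`, which gives the strict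
  -- derivative needed for local inversion.
  have hstrict : HasStrictFDerivAt ψ f' η :=
    hasStrictFDerivAt_of_hasFDerivAt_of_continuousAt
      (eventually_of_mem hΘ fun y hy =>
        (hψ.differentiableOn.differentiableAt (hψ.isOpen.mem_nhds hy)).hasFDerivAt)
      (hψ.twice_differentiableOn.differentiableAt hΘ).continuousAt
  have hsum1 : ∀ s ∈ Θ, ∑ x, ψ s x = 1 := fun s hs => (hψ.bijOn.mapsTo hs).2.2
  have hsum0 : ∀ z, ∑ x, f' z x = 0 := by
    intro z
    have h1 : HasFDerivAt (fun s => ∑ x, ψ s x)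
        (∑ x, (ContinuousLinearMap.proj x).comp f') η :=
      HasFDerivAt.fun_sum fun x _ => (hasFDerivAt_pi'.1 hstrict.hasFDerivAt x)
    have h2 : HasFDerivAt (fun s => ∑ x, ψ s x) (0 : _ →L[ℝ] ℝ) η :=
      (hasFDerivAt_const (1 : ℝ) η).congr_of_eventuallyEq (eventually_of_mem hΘ hsum1)
    simpa using DFunLike.congr_fun (h1.unique h2) z
  have hrange : ∀ y : S → ℝ, ∑ x, y x = 0 → y ∈ f'.range := fun y hy =>
    mem_range_of_sum_eq_zero (f := (f' : _ →ₗ[ℝ] S → ℝ)) finrank_euclideanSpace_fin hinj hsum0 hy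
  have hsegment : ∀ M ∈ 𝓜, M ⊆ openSimplex S → ψ η ∈ M → ∀ L : Submodule ℝ (S → ℝ),
      modelTangentCone M (ψ η) = L → ∀ k, f' k ∈ L →
      ∃ ε : ℝ, 0 < ε ∧ ∀ δ, 0 ≤ δ → δ ≤ ε → ψ (η + δ • k) ∈ M := by
    intro M hM hMS hθM L hL k hk
    obtain ⟨N, hN, hNc⟩ := hconv M hM
    have hηC : η ∈ (Θ ∩ ψ ⁻¹' M) ∩ N := ⟨⟨hη, hθM⟩, mem_of_mem_nhds hN⟩
    have hTC : modelTangentCone ((Θ ∩ ψ ⁻¹' M) ∩ N) η =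
        (L.comap f'.toLinearMap : Submodule ℝ (EuclideanSpace ℝ (Fin (Fintype.card S - 1)))) := by
      rw [modelTangentCone_inter_of_mem_nhds hN, modelTangentCone_preimage hstrict hinj hΘ, hL]
      · rfl
      · intro s hs t ht
        refine hrange _ ?_
        simp [Finset.sum_sub_distrib, hsum1 s hs, (hMS ht).2]
    obtain ⟨ε, hε, hεC⟩ := hNc.exists_add_smul_mem hηC _ hTC hk
    exact ⟨ε, hε, fun δ h0 h1 => (hNc.line_mem hηC hε hεC h0 h1).1.2⟩
  have hh0 : ∑ x, h x = 0 := by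
    obtain ⟨α, t, -, ht, -, h2⟩ := hh₁
    refine tendsto_nhds_unique (tendsto_finsetSum Finset.univ fun x _ => tendsto_pi_nhds.1 h2 x)
      (tendsto_const_nhds.congr fun n => ?_)
    simp [← Finset.mul_sum, Finset.sum_sub_distrib, (hS₁ (ht n)).2, hsum1 η hη]
  -- Both models contain the image of a segment from `η` in the direction `k`; along the shorter one
  -- the scaled differences tend to `f' k = h`, against the overlap.
  obtain ⟨k, hk⟩ := hrange h hh0
  have hk' : f' k = h := hk
  obtain ⟨ε₁, hε₁, hm₁⟩ := hsegment M₁ hM₁ hS₁ hθ₁ L₁ hL₁ k (by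
    rw [hk', ← SetLike.mem_coe, ← hL₁]
    exact hh₁)
  obtain ⟨ε₂, hε₂, hm₂⟩ := hsegment M₂ hM₂ hS₂ hθ₂ L₂ hL₂ k (by
    rw [hk', ← SetLike.mem_coe, ← hL₂]
    exact hh₂)
  set ε := min ε₁ ε₂ with hεdef
  have hε : 0 < ε := lt_min hε₁ hε₂
  obtain ⟨h1, h2⟩ := tendsto_smul_line_sub η k hε
  have hδ : ∀ n : ℕ, ε * (1 / ((n : ℝ) + 1)) ≤ ε := fun n => by
    refine mul_le_of_le_one_right hε.le ((div_le_one (by positivity)).2 ?_)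
    linarith [n.cast_nonneg (α := ℝ)]
  refine hh ⟨fun n : ℕ => ((n : ℝ) + 1) / ε, fun n : ℕ => ψ (η + (ε * (1 / ((n : ℝ) + 1))) • k),
    fun n => by positivity, fun n => ⟨hm₁ _ (by positivity) ((hδ n).trans (min_le_left _ _)),
      hm₂ _ (by positivity) ((hδ n).trans (min_le_right _ _))⟩,
    hstrict.hasFDerivAt.continuousAt.tendsto.comp h1, ?_⟩
  have hd : Tendsto (fun n : ℕ => η + (ε * (1 / ((n : ℝ) + 1))) • k - η) atTop (𝓝 0) := by
    simpa using h1.sub_const η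
  have := (hstrict.hasFDerivAt.hasFDerivWithinAt (s := Set.univ)).lim hd
    (.of_forall fun _ => Set.mem_univ _) h2
  simpa only [hk', add_sub_cancel] using this

/-! ### Bayesian networks are not simultaneously convex -/

theorem not_simultaneouslyConvexNear_of_collider {V : Type*} [Fintype V] [DecidableEq V]
    {X : V → Type*} [∀ v, Fintype (X v)] [∀ v, Nontrivial (X v)] {G₁ G₂ : Digraph V} {i j k : V}
    (hG₁ : G₁.IsDAG) (hG₂ : G₂.IsDAG) (hcol : G₁.UnshieldedCollider i k j)
    (hnon : G₂.UnshieldedNoncollider i k j) {𝓜 : Set (Set ((∀ v, X v) → ℝ))}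
    (h₁ : bayesNetModel X G₁ ∈ 𝓜) (h₂ : bayesNetModel X G₂ ∈ 𝓜) :
    ¬ SimultaneouslyConvexNear 𝓜 (uniformPoint X) :=
  (overlapAt_uniformPoint hG₁ hG₂ hcol hnon).not_simultaneouslyConvexNear h₁ h₂
    (fun _ hp => hp.1) (fun _ hp => hp.1) _ _ (modelTangentCone_bayesNetModel hG₁)
    (modelTangentCone_bayesNetModel hG₂)

theorem Digraph.isDAG_of_rank {V : Type*} {G : Digraph V} (r : V → ℕ)
    (hr : ∀ u v, G.Adj u v → r u < r v) : G.IsDAG := by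
  intro v hv
  have : ∀ w, Relation.TransGen G.Adj v w → r v < r w := fun w hw => by
    induction hw with
    | single h => exact hr _ _ h
    | tail _ h ih => exact ih.trans (hr _ _ h)
  exact lt_irrefl _ (this v hv)

theorem exists_collider_and_noncollider {V : Type*} (hV : ∃ i j k : V, i ≠ j ∧ i ≠ k ∧ j ≠ k) :
    ∃ (G₁ G₂ : Digraph V) (i j k : V), G₁.IsDAG ∧ G₂.IsDAG ∧ G₁.UnshieldedCollider i k j ∧
      G₂.UnshieldedNoncollider i k j := by
  classical
  obtain ⟨i, j, k, hij, hik, hjk⟩ := hV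
  -- The witnesses are `i → k ← j` and `i ← k → j`, with all other vertices isolated.
  refine ⟨⟨fun u v => (u = i ∨ u = j) ∧ v = k⟩, ⟨fun u v => u = k ∧ (v = i ∨ v = j)⟩, i, j, k,
    Digraph.isDAG_of_rank (fun v => if v = k then 1 else 0) ?_,
    Digraph.isDAG_of_rank (fun v => if v = k then 0 else 1) ?_, ?_, ?_⟩
  · rintro u v ⟨rfl | rfl, rfl⟩ <;> simp [*]
  · rintro u v ⟨rfl, rfl | rfl⟩ <;> simp [*]
  · simp [Digraph.UnshieldedCollider, Digraph.Joined, *]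
  · simp [Digraph.UnshieldedNoncollider, Digraph.Joined, *]

theorem mainTheorem9 {V : Type*} [Fintype V] [DecidableEq V] (X : V → Type*)
    [∀ v, Fintype (X v)] [∀ v, Nontrivial (X v)] :
    (∀ (G₁ G₂ : Digraph V) (i j k : V), G₁.IsDAG → G₂.IsDAG →
      G₁.UnshieldedCollider i k j → G₂.UnshieldedNoncollider i k j → Fintype.card (X k) = 2 →
      ∃ θ, OverlapAt (bayesNetModel X G₁) (bayesNetModel X G₂) θ ∧
        ¬ SimultaneouslyConvexNear {bayesNetModel X G₁, bayesNetModel X G₂} θ) ∧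
    (3 ≤ Fintype.card V → (∃ k, Fintype.card (X k) = 2) →
      ∃ θ, (∀ M ∈ bayesNetModels X, θ ∈ M) ∧
        ¬ SimultaneouslyConvexNear (bayesNetModels X) θ) := by
  refine ⟨fun G₁ G₂ i j k hG₁ hG₂ hcol hnon _ => ⟨uniformPoint X,
    overlapAt_uniformPoint hG₁ hG₂ hcol hnon,
    not_simultaneouslyConvexNear_of_collider hG₁ hG₂ hcol hnon (by simp) (by simp)⟩,
    fun hV _ => ⟨uniformPoint X, ?_, ?_⟩⟩
  · rintro M ⟨G, hG, rfl⟩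
    exact uniformPoint_mem_bayesNetModel hG
  · obtain ⟨G₁, G₂, i, j, k, hG₁, hG₂, hcol, hnon⟩ :=
      exists_collider_and_noncollider (Fintype.two_lt_card_iff.1 hV)
    exact not_simultaneouslyConvexNear_of_collider hG₁ hG₂ hcol hnon ⟨G₁, hG₁, rfl⟩
      ⟨G₂, hG₂, rfl⟩
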